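/- Let $A$ be a densely defined closed symmetric operator in a complex Hilbert space $\mathcal H$ with deficiency indices $(n,n)$, $n<\infty$, and let $\{u_j\}_{j=1}^n$ be an orthonormal basis of $\ker(A^*-i)$ (inner products are linear in the second argument). Let $A_\alpha,A_\beta$ be self-adjoint extensions of $A$ with von Neumann parameters $\mathcal U_\alpha,\mathcal U_\beta:\ker(A^*-i)\to\ker(A^*+i)$, that is, isometric isomorphisms such that for $\ell\in\{\alpha,\beta\}$ $$\mathcal D(A_\ell)=\{g+(I+\mathcal U_\ell)w: g\in\mathcal D(A),\,w\in\ker(A^*-i)\},\qquad A_\ell(g+(I+\mathcal U_\ell)w)=Ag+i(I-\mathcal U_\ell)w .$$ Define the Weyl matrices $M_\ell(z)=zI_n+(1+z^2)\big((u_j,(A_\ell-z)^{-1}u_k)\big)_{1\le j,k\le n}$ for $z\in\rho(A_\ell)$. For matrices, $\cos\alpha=(e^{i\alpha}+e^{-i\alpha})/2$ and $\sin\alpha=(e^{i\alpha}-e^{-i\alpha})/(2i)$. Put $C(\alpha,\beta)=e^{-i\beta}(\cos\beta\cos\alpha+\sin\beta\sin\alpha)e^{i\alpha}$ and $S(\alpha,\beta)=e^{-i\beta}(\sin\beta\cos\alpha-\cos\beta\sin\alpha)e^{i\alpha}$.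 (1) Let $\{v_j\}_{j=1}^n$ be any (not necessarily orthogonal) basis of $\ker(A^*+i)$, and let $\alpha,\beta\in M_n(\mathbb C)$ be such that $e^{2i\alpha},e^{2i\beta}$ are the matrices of $\mathcal U_\alpha,\mathcal U_\beta$ with respect to $\{u_j\}$ and $\{v_j\}$ (so $\mathcal U_\alpha u_j=\sum_k (e^{2i\alpha})_{k,j}v_k$, and likewise for $\beta$). Then for all $z\in\rho(A_\alpha)\cap\rho(A_\beta)$ the matrix $C(\alpha,\beta)+S(\alpha,\beta)M_\alpha(z)$ is invertible and $$M_\beta(z)=\big(-S(\alpha,\beta)+C(\alpha,\beta)M_\alpha(z)\big)\big(C(\alpha,\beta)+S(\alpha,\beta)M_\alpha(z)\big)^{-1}.$$ (2) The matrices $C(\alpha,\beta)$ and $S(\alpha,\beta)$ in (1) do not depend on the basis $\{v_j\}$, nor on the choice of $\alpha,\beta$ for that basis. (3) Put $u_{\alpha,j}(\zeta)=u_j+(\zeta-i)(A_\alpha-\zeta)^{-1}u_j$. There is exactly one matrix $P\in M_n(\mathbb C)$ with $$(A_\beta-i)^{-1}=(A_\alpha-i)^{-1}+\sum_{j,k=1}^nP_{j,k}\,(u_{\alpha,k}(-i),\cdot\,)\,u_{\alpha,j}(i),$$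 and with this $P$, for all $z\in\rho(A_\alpha)\cap\rho(A_\beta)$, the matrix $(I_n+iP)-PM_\alpha(z)$ is invertible and $$M_\beta(z)=\big(P+(I_n+iP)M_\alpha(z)\big)\big((I_n+iP)-PM_\alpha(z)\big)^{-1}.$$ If moreover $\gamma\in M_n(\mathbb C)$ satisfies $\mathcal U_\beta u_j=\sum_k(e^{2i\gamma})_{k,j}\,u_{\alpha,k}(-i)$ for all $j$, then for the same $z$ the matrix $\sin\gamma-\cos\gamma\,M_\alpha(z)$ is invertible and $$M_\beta(z)=e^{-i\gamma}(\cos\gamma+\sin\gamma\,M_\alpha(z))(\sin\gamma-\cos\gamma\,M_\alpha(z))^{-1}e^{i\gamma}.$$ -/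

import Mathlib

open scoped InnerProductSpace

namespace LinearPMap

variable {H : Type*} [NormedAddCommGroup H] [InnerProductSpace ℂ H]

/-- `R` is a bounded two-sided inverse of `T - z`, where `T` is an unbounded operator in `H`. -/
structure IsResolventAt (T : H →ₗ.[ℂ] H) (z : ℂ) (R : H →L[ℂ] H) : Prop where
  /-- `R` maps `H` into the domain of `T`. -/
  mem_domain : ∀ x : H, R x ∈ T.domain
  /-- `(T - z) R = I`. -/
  right_inv : ∀ x : H, T ⟨R x, mem_domain x⟩ - z • R x = x
  /-- `R (T - z) = I` on the domain of `T`. -/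
  left_inv : ∀ x : T.domain, R (T x - z • (x : H)) = x

theorem IsResolventAt.unique {T : H →ₗ.[ℂ] H} {z : ℂ} {R S : H →L[ℂ] H}
    (hR : T.IsResolventAt z R) (hS : T.IsResolventAt z S) : R = S := by
  ext x
  have h := hS.left_inv ⟨R x, hR.mem_domain x⟩
  rw [hR.right_inv x] at h
  exact h.symm

/-- The resolvent set `ρ(T)`: the complex numbers `z` for which `T - z` is a bijection of the
domain of `T` onto `H` with bounded inverse. -/
def resolventSet (T : H →ₗ.[ℂ] H) : Set ℂ := {z | ∃ R : H →L[ℂ] H, T.IsResolventAt z R}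

open scoped Classical in
/-- The resolvent `(T - z)⁻¹`, a bounded operator on `H` for `z ∈ ρ(T)` (and `0` otherwise). -/
noncomputable def resolvent (T : H →ₗ.[ℂ] H) (z : ℂ) : H →L[ℂ] H :=
  if h : ∃ R : H →L[ℂ] H, T.IsResolventAt z R then h.choose else 0

theorem isResolventAt_resolvent {T : H →ₗ.[ℂ] H} {z : ℂ} (hz : z ∈ T.resolventSet) :
    T.IsResolventAt z (T.resolvent z) := by
  have h : ∃ R : H →L[ℂ] H, T.IsResolventAt z R := hz
  rw [resolvent, dif_pos h]
  exact h.choose_spec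

/-- The map `I + (z - z₀)(T - z)⁻¹ = (T - z₀)(T - z)⁻¹`. -/
noncomputable def transport (T : H →ₗ.[ℂ] H) (z z₀ : ℂ) : H →L[ℂ] H :=
  ContinuousLinearMap.id ℂ H + (z - z₀) • T.resolvent z

/-- The Weyl matrix
`M(z) = z I + (1 + z²) ((u_j, (T - z)⁻¹ u_k))_{j,k}` of `T` with respect to vectors `u_j` in a
subspace `K` (in the theorem, `K = ker (A* - i)`). -/
noncomputable def weylMatrix {n : ℕ} (T : H →ₗ.[ℂ] H) {K : Submodule ℂ H} (u : Fin n → K) (z : ℂ) :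
    Matrix (Fin n) (Fin n) ℂ :=
  z • (1 : Matrix (Fin n) (Fin n) ℂ) +
    (1 + z ^ 2) • Matrix.of fun j k => ⟪(u j : H), T.resolvent z (u k : H)⟫_ℂ

/-- Krein's formula at the point `z`, for the operators `T₁`, `T₂`, vectors `u_j` (a basis of the
deficiency space at `i`), and the coefficient matrix `P`: with
`u_{1,j}(ζ) = (T₁ - i)(T₁ - ζ)⁻¹ u_j`,
`(T₂ - z)⁻¹ = (T₁ - z)⁻¹ + ∑_{j,k} P_{j,k} (u_{1,k}(z̄), ·) u_{1,j}(z)`. -/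
def IsKreinMatrix {n : ℕ} (T₁ T₂ : H →ₗ.[ℂ] H) {K : Submodule ℂ H} (u : Fin n → K)
    (z : ℂ) (P : Matrix (Fin n) (Fin n) ℂ) : Prop :=
  ∀ x : H, T₂.resolvent z x = T₁.resolvent z x +
    ∑ j, ∑ k, (P j k * ⟪T₁.transport (starRingEnd ℂ z) Complex.I (u k : H), x⟫_ℂ) •
      T₁.transport z Complex.I (u j : H)

variable [CompleteSpace H]

/-- The deficiency space `ker (A* - z)`, as a subspace of `H`. -/
noncomputable def defectSpace (A : H →ₗ.[ℂ] H) (z : ℂ) : Submodule ℂ H :=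
  (LinearMap.ker (A.adjoint.toFun - z • A.adjoint.domain.subtype)).map A.adjoint.domain.subtype

theorem mem_defectSpace {A : H →ₗ.[ℂ] H} {z : ℂ} {x : H} :
    x ∈ A.defectSpace z ↔ ∃ h : x ∈ A.adjoint.domain, A.adjoint ⟨x, h⟩ = z • x := by
  simp only [defectSpace, Submodule.mem_map, LinearMap.mem_ker, LinearMap.sub_apply,
    LinearMap.smul_apply, Submodule.subtype_apply, sub_eq_zero, Subtype.exists]
  constructor
  · rintro ⟨y, hy, h, rfl⟩
    exact ⟨hy, h⟩
  · rintro ⟨hx, h⟩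
    exact ⟨x, hx, h, rfl⟩

/-- The isometric isomorphism `V : ker (A* - i) → ker (A* + i)` is the von Neumann parameter of the
extension `B` of `A`: the domain of `B` consists of the vectors `g + (I + V) w` with `g` in the
domain of `A` and `w ∈ ker (A* - i)`, and `B (g + (I + V) w) = A g + i (I - V) w`. -/
structure IsVonNeumannParameter (A B : H →ₗ.[ℂ] H)
    (V : A.defectSpace Complex.I ≃ₗᵢ[ℂ] A.defectSpace (-Complex.I)) : Prop where
  mem_domain_iff : ∀ x : H, x ∈ B.domain ↔
    ∃ (g : A.domain) (w : A.defectSpace Complex.I), x = (g : H) + ((w : H) + (V w : H))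
  apply_eq : ∀ (g : A.domain) (w : A.defectSpace Complex.I)
    (h : (g : H) + ((w : H) + (V w : H)) ∈ B.domain),
    B ⟨(g : H) + ((w : H) + (V w : H)), h⟩ = A g + Complex.I • ((w : H) - (V w : H))

end LinearPMap

namespace MatrixTrig

variable {n : ℕ}

/-- The matrix exponential `e^{i c α}`. -/
noncomputable def expI (c : ℂ) (α : Matrix (Fin n) (Fin n) ℂ) : Matrix (Fin n) (Fin n) ℂ :=
  NormedSpace.exp ((Complex.I * c) • α)

/-- The matrix cosine `cos α = (e^{iα} + e^{-iα}) / 2`. -/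
noncomputable def cos (α : Matrix (Fin n) (Fin n) ℂ) : Matrix (Fin n) (Fin n) ℂ :=
  (1 / 2 : ℂ) • (expI 1 α + expI (-1) α)

/-- The matrix sine `sin α = (e^{iα} - e^{-iα}) / (2i)`. -/
noncomputable def sin (α : Matrix (Fin n) (Fin n) ℂ) : Matrix (Fin n) (Fin n) ℂ :=
  (1 / (2 * Complex.I) : ℂ) • (expI 1 α - expI (-1) α)

/-- The block `e^{-iβ} (cos β cos α + sin β sin α) e^{iα}`. -/
noncomputable def cosBlock (α β : Matrix (Fin n) (Fin n) ℂ) : Matrix (Fin n) (Fin n) ℂ :=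
  expI (-1) β * (cos β * cos α + sin β * sin α) * expI 1 α

/-- The block `e^{-iβ} (sin β cos α - cos β sin α) e^{iα}`. -/
noncomputable def sinBlock (α β : Matrix (Fin n) (Fin n) ℂ) : Matrix (Fin n) (Fin n) ℂ :=
  expI (-1) β * (sin β * cos α - cos β * sin α) * expI 1 α

end MatrixTrig

/-! ### Exponential form of the trigonometric blocks. -/

namespace MatrixTrig

variable {n : ℕ}

/-! Everything depends on the two extensions only through `Q`, the matrix of `V₂⁻¹ V₁` on `ker (A* -
i)`.

Write `(B₁ - z)⁻¹ w₀ = g + v + V₁ v`. Pairing with `ker (A* - i)` gives `(M₁ - i) w₀ = 2i(z - i) v`.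
Keep `g` and the component in `ker (A* + i)`, but replace `v` by `v' = V₂⁻¹ V₁ v`: the new vector
lies in the domain of `B₂`, and `B₂ - z` sends it to `w₀ + (z - i)(v - v')`, again in `ker (A* -
i)`. Reading off `M₂` there gives `(M₂ - i) D = 2i Q (M₁ - i)` with `D = (M₁ + i) - Q (M₁ - i)`
(`weylMatrix_sub_I_mul`). Exchanging the extensions shows that `D` is invertible.

The three formulas are this relation in three parametrizations: `Q = e^{-2iβ} e^{2iα}`, `P = (i/2)(1
- Q)` and `Q = -e^{-2iγ}`. The last two use `u_{α,k}(-i) = -Vα u_k`. -/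

theorem expI_zero (α : Matrix (Fin n) (Fin n) ℂ) : expI 0 α = 1 := by
  simp [expI]

theorem expI_mul (c d : ℂ) (α : Matrix (Fin n) (Fin n) ℂ) :
    expI c α * expI d α = expI (c + d) α := by
  rw [expI, expI, expI, mul_add, add_smul, Matrix.exp_add_of_commute]
  exact ((Commute.refl α).smul_left _).smul_right _

theorem expI_mul_of_add {c d e : ℂ} (h : c + d = e) (α : Matrix (Fin n) (Fin n) ℂ) :
    expI c α * expI d α = expI e α := by
  rw [expI_mul, h]

theorem expI_mul_expI_neg (c : ℂ) (α : Matrix (Fin n) (Fin n) ℂ) :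
    expI c α * expI (-c) α = 1 := by
  rw [expI_mul_of_add (add_neg_cancel c), expI_zero]

theorem expI_neg_mul_expI (c : ℂ) (α : Matrix (Fin n) (Fin n) ℂ) :
    expI (-c) α * expI c α = 1 := by
  rw [expI_mul_of_add (neg_add_cancel c), expI_zero]

theorem expI_mul_conj (a b : Matrix (Fin n) (Fin n) ℂ) (c d e f : ℂ) :
    expI c a * (expI d a * expI e b) * expI f b = expI (c + d) a * expI (e + f) b := by
  rw [← expI_mul, ← expI_mul]
  simp only [mul_assoc]

/-- The matrices `α` and `β` need not commute, so no addition formula is available; the outer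
factors in the block turn the mixed products into `1` and `e^{-2iβ} e^{2iα}`. Only the exponentials
of `2iα` and `2iβ` survive, hence independence of the logarithms. -/
theorem cosBlock_eq (α β : Matrix (Fin n) (Fin n) ℂ) :
    cosBlock α β = (1 / 2 : ℂ) • (1 + expI (-2) β * expI 2 α) := by
  have h : cos β * cos α + sin β * sin α =
      (1 / 2 : ℂ) • (expI 1 β * expI (-1) α + expI (-1) β * expI 1 α) := by
    have hI : (1 / (2 * Complex.I) : ℂ) * (1 / (2 * Complex.I)) = -(1 / 4) := by
      field_simp; norm_num
    simp only [cos, sin, smul_mul_smul_comm, hI, mul_add, add_mul, mul_sub, sub_mul]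
    module
  rw [cosBlock, h, mul_smul_comm, smul_mul_assoc, mul_add, add_mul, expI_mul_conj, expI_mul_conj]
  norm_num [expI_zero]

theorem sinBlock_eq (α β : Matrix (Fin n) (Fin n) ℂ) :
    sinBlock α β = (1 / (2 * Complex.I) : ℂ) • (1 - expI (-2) β * expI 2 α) := by
  have h : sin β * cos α - cos β * sin α =
      (1 / (2 * Complex.I) : ℂ) • (expI 1 β * expI (-1) α - expI (-1) β * expI 1 α) := by
    simp only [cos, sin, smul_mul_smul_comm, mul_comm (1 / 2 : ℂ),
      mul_add, add_mul, mul_sub, sub_mul]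
    module
  rw [sinBlock, h, mul_smul_comm, smul_mul_assoc, mul_sub, sub_mul, expI_mul_conj, expI_mul_conj]
  norm_num [expI_zero]

end MatrixTrig

/-! ### Resolvents of self-adjoint operators at `± i`. -/

namespace LinearPMap

variable {H : Type*} [NormedAddCommGroup H] [InnerProductSpace ℂ H]

theorem resolvent_apply_eq {T : H →ₗ.[ℂ] H} {z : ℂ} (hz : z ∈ T.resolventSet) (y : T.domain)
    {x : H} (hx : T y - z • (y : H) = x) : T.resolvent z x = y := by
  rw [← hx]
  exact (isResolventAt_resolvent hz).left_inv y

theorem transport_I_I (B : H →ₗ.[ℂ] H) (x : H) : B.transport Complex.I Complex.I x = x := by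
  simp [transport]

/-- For a symmetric operator and a purely imaginary `c` of modulus one,
`‖(T - c) x‖² = ‖T x‖² + ‖x‖²`. -/
theorem IsFormalAdjoint.norm_sub_smul_sq {T : H →ₗ.[ℂ] H} (hT : T.IsFormalAdjoint T) {c : ℂ}
    (hc : starRingEnd ℂ c = -c) (hc1 : ‖c‖ = 1) (x : T.domain) :
    ‖T x - c • (x : H)‖ ^ 2 = ‖T x‖ ^ 2 + ‖(x : H)‖ ^ 2 := by
  have h : (⟪T x, c • (x : H)⟫_ℂ).re = 0 := by
    have h1 : starRingEnd ℂ ⟪T x, c • (x : H)⟫_ℂ = -⟪T x, c • (x : H)⟫_ℂ := by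
      rw [inner_conj_symm, inner_smul_left, inner_smul_right, hc, hT x x, neg_mul]
    have h2 := congrArg Complex.re h1
    simp only [Complex.conj_re, Complex.neg_re] at h2
    linarith
  rw [norm_sub_sq (𝕜 := ℂ), norm_smul, hc1]
  simp [h]

variable [CompleteSpace H]

theorem isFormalAdjoint_of_isSelfAdjoint {T : H →ₗ.[ℂ] H} (hT : IsSelfAdjoint T) :
    T.IsFormalAdjoint T := by
  have h := adjoint_isFormalAdjoint (T := T) hT.dense_domain
  rwa [isSelfAdjoint_def.mp hT] at h

/-- The points `± i` belong to the resolvent set of a self-adjoint operator. -/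
theorem mem_resolventSet_of_isSelfAdjoint {T : H →ₗ.[ℂ] H} (hT : IsSelfAdjoint T) {c : ℂ}
    (hc : starRingEnd ℂ c = -c) (hc1 : ‖c‖ = 1) : c ∈ T.resolventSet := by
  have hc_neg : starRingEnd ℂ (-c) = - -c := by simp [hc]
  have hsymm := isFormalAdjoint_of_isSelfAdjoint hT
  have hclosed : _root_.IsClosed (T.graph : Set (H × H)) := hT.isClosed
  have : CompleteSpace T.graph := hclosed.completeSpace_coe
  -- On the graph, complete because `T` is closed, `T - c` becomes a bounded operator; the norm
  -- identity bounds it below, so it is injective with closed range.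
  let F : T.graph →L[ℂ] H :=
    (ContinuousLinearMap.snd ℂ H H - c • ContinuousLinearMap.fst ℂ H H).comp T.graph.subtypeL
  have hF (p : T.graph) : F p = (p : H × H).2 - c • (p : H × H).1 := rfl
  have hanti : AntilipschitzWith 1 F := by
    refine AddMonoidHomClass.antilipschitz_of_bound F fun p => ?_
    obtain ⟨y, hy1, hy2⟩ := (mem_graph_iff T).mp p.2
    have h := hsymm.norm_sub_smul_sq hc hc1 y
    rw [hy1, hy2, ← hF] at h
    rw [NNReal.coe_one, one_mul]
    change max ‖(p : H × H).1‖ ‖(p : H × H).2‖ ≤ _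
    refine max_le ?_ ?_ <;> refine (sq_le_sq₀ (norm_nonneg _) (norm_nonneg _)).mp ?_ <;>
      nlinarith [sq_nonneg ‖(p : H × H).1‖, sq_nonneg ‖(p : H × H).2‖]
  have hker : F.ker = ⊥ := LinearMap.ker_eq_bot.mpr hanti.injective
  have hrange : F.range = ⊤ := by
    have hc' : _root_.IsClosed (F.range : Set H) := by
      rw [LinearMap.coe_range]
      exact hanti.isClosed_range F.uniformContinuous
    have : CompleteSpace F.range := hc'.completeSpace_coe
    rw [← Submodule.orthogonal_eq_bot_iff, Submodule.eq_bot_iff]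
    intro y hy
    -- A vector orthogonal to the range satisfies `T* y = -c y`; as `T* = T`, the norm identity at
    -- `-c` then forces `y = 0`.
    have hy' (x : T.domain) : ⟪(-c) • y, (x : H)⟫_ℂ = ⟪y, T x⟫_ℂ := by
      have h := (Submodule.mem_orthogonal' _ _).mp hy _ ⟨⟨_, mem_graph T x⟩, rfl⟩
      change ⟪y, F ⟨_, mem_graph T x⟩⟫_ℂ = 0 at h
      rw [hF, inner_sub_right, inner_smul_right, sub_eq_zero] at h
      rw [inner_smul_left, hc_neg, neg_neg]
      exact h.symm
    have hyd : y ∈ T.adjoint.domain := mem_adjoint_domain_of_exists _ ⟨_, hy'⟩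
    have hya : T.adjoint ⟨y, hyd⟩ = (-c) • y := adjoint_apply_eq hT.dense_domain _ hy'
    have hgr : ((y, (-c) • y) : H × H) ∈ T.adjoint.graph :=
      (mem_graph_iff _).mpr ⟨⟨y, hyd⟩, rfl, hya⟩
    rw [isSelfAdjoint_def.mp hT] at hgr
    obtain ⟨x, hx1, hx2⟩ := (mem_graph_iff T).mp hgr
    have h := hsymm.norm_sub_smul_sq (c := -c) hc_neg (by rwa [norm_neg]) x
    simp only at hx1 hx2
    rw [hx2, hx1, sub_self, norm_zero] at h
    have : ‖y‖ ^ 2 = 0 := by nlinarith [sq_nonneg ‖y‖, sq_nonneg ‖(-c) • y‖]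
    simpa using this
  let e := ContinuousLinearEquiv.ofBijective F hker hrange
  have hmem (x : H) : ∃ y : T.domain, (y : H) = (e.symm x : H × H).1 ∧ T y = (e.symm x : H × H).2 :=
    (mem_graph_iff T).mp (e.symm x).2
  let R : H →L[ℂ] H :=
    (ContinuousLinearMap.fst ℂ H H).comp (T.graph.subtypeL.comp (e.symm : H →L[ℂ] T.graph))
  have hR (x : H) : R x = (e.symm x : H × H).1 := rfl
  have hR_mem (x : H) : R x ∈ T.domain := by
    obtain ⟨y, hy, -⟩ := hmem x
    rw [hR, ← hy]
    exact y.2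
  refine ⟨R, hR_mem, fun x => ?_, fun x => ?_⟩
  · obtain ⟨y, hy, hy2⟩ := hmem x
    have hy' : (⟨R x, hR_mem x⟩ : T.domain) = y := Subtype.ext hy.symm
    have h : e (e.symm x) = x := e.apply_symm_apply x
    change F (e.symm x) = x at h
    rw [hF, ← hR, ← hy2] at h
    rw [hy', h]
  · have h : T x - c • (x : H) = e ⟨((x : H), T x), mem_graph T x⟩ := rfl
    simp [h, hR]

theorem I_mem_resolventSet {T : H →ₗ.[ℂ] H} (hT : IsSelfAdjoint T) :
    Complex.I ∈ T.resolventSet :=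
  mem_resolventSet_of_isSelfAdjoint hT Complex.conj_I Complex.norm_I

theorem neg_I_mem_resolventSet {T : H →ₗ.[ℂ] H} (hT : IsSelfAdjoint T) :
    -Complex.I ∈ T.resolventSet :=
  mem_resolventSet_of_isSelfAdjoint hT (by simp) (by simp)

end LinearPMap


/-! ### Extensions described by von Neumann parameters. -/

namespace LinearPMap

variable {H : Type*} [NormedAddCommGroup H] [InnerProductSpace ℂ H] [CompleteSpace H]
  {A B B₁ B₂ : H →ₗ.[ℂ] H}
  {V V₁ V₂ : A.defectSpace Complex.I ≃ₗᵢ[ℂ] A.defectSpace (-Complex.I)} {z : ℂ}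

theorem inner_defectSpace_apply (hA : Dense (A.domain : Set H)) {c : ℂ} (w : A.defectSpace c)
    (g : A.domain) : ⟪(w : H), A g⟫_ℂ = starRingEnd ℂ c * ⟪(w : H), (g : H)⟫_ℂ := by
  obtain ⟨hw, h⟩ := mem_defectSpace.mp w.2
  rw [← adjoint_isFormalAdjoint hA ⟨w, hw⟩ g, h, inner_smul_left]

theorem IsVonNeumannParameter.add_mem_domain (hV : A.IsVonNeumannParameter B V) (g : A.domain)
    (w : A.defectSpace Complex.I) : (g : H) + ((w : H) + (V w : H)) ∈ B.domain :=
  (hV.mem_domain_iff _).mpr ⟨g, w, rfl⟩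

/-- The decomposition of `(B - z)⁻¹ x` given by the von Neumann parameter of `B`. -/
theorem IsVonNeumannParameter.exists_resolvent_eq (hV : A.IsVonNeumannParameter B V)
    (hz : z ∈ B.resolventSet) (x : H) :
    ∃ (g : A.domain) (w : A.defectSpace Complex.I),
      B.resolvent z x = (g : H) + ((w : H) + (V w : H)) ∧
      A g + Complex.I • ((w : H) - (V w : H)) - z • ((g : H) + ((w : H) + (V w : H))) = x := by
  have hR := isResolventAt_resolvent hz
  obtain ⟨g, w, h⟩ := (hV.mem_domain_iff _).mp (hR.mem_domain x)
  refine ⟨g, w, h, ?_⟩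
  rw [← hV.apply_eq g w (hV.add_mem_domain g w)]
  have h' : (⟨_, hV.add_mem_domain g w⟩ : B.domain) = ⟨B.resolvent z x, hR.mem_domain x⟩ :=
    Subtype.ext h.symm
  rw [h', ← h, hR.right_inv x]

theorem IsVonNeumannParameter.resolvent_eq (hV : A.IsVonNeumannParameter B V)
    (hz : z ∈ B.resolventSet) (g : A.domain) (w : A.defectSpace Complex.I) {x : H}
    (hx : A g + Complex.I • ((w : H) - (V w : H)) - z • ((g : H) + ((w : H) + (V w : H))) = x) :
    B.resolvent z x = (g : H) + ((w : H) + (V w : H)) := by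
  refine resolvent_apply_eq hz ⟨_, hV.add_mem_domain g w⟩ ?_
  rw [hV.apply_eq, hx]

/-- The component in `ker (A* - i)` of a vector is determined by the image of the vector under
`B - z` and by inner products. -/
theorem two_I_mul_inner_defectSpace (hA : Dense (A.domain : Set H)) (g : A.domain)
    (w w' : A.defectSpace Complex.I) {x y : H} (hy : y = (g : H) + ((w : H) + (V w : H)))
    (hx : A g + Complex.I • ((w : H) - (V w : H)) - z • ((g : H) + ((w : H) + (V w : H))) = x) :
    2 * Complex.I * ⟪(w' : H), (w : H)⟫_ℂ =
      ⟪(w' : H), x⟫_ℂ + (z + Complex.I) * ⟪(w' : H), y⟫_ℂ := by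
  subst hx hy
  simp only [inner_sub_right, inner_add_right, inner_smul_right, inner_defectSpace_apply hA,
    Complex.conj_I]
  ring

/-- Taking `g = 0`, `B + i` sends `w + V w` to `i(w - V w) + i(w + V w) = 2i w`. Thus `(B - i)(B +
i)⁻¹` is `-V` on `ker (A* - i)`. -/
theorem transport_neg_I_I (hV : A.IsVonNeumannParameter B V) (hz : -Complex.I ∈ B.resolventSet)
    (w : A.defectSpace Complex.I) :
    B.transport (-Complex.I) Complex.I (w : H) = -(V w : H) := by
  have h : B.resolvent (-Complex.I) ((2 * Complex.I) • (w : H)) = (w : H) + (V w : H) := by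
    have := hV.resolvent_eq hz 0 w (x := (2 * Complex.I) • (w : H)) (by
      simp only [map_zero, Submodule.coe_zero]
      module)
    simpa using this
  have h2 : (-Complex.I - Complex.I : ℂ) = -(2 * Complex.I) := by ring
  change (w : H) + (-Complex.I - Complex.I) • B.resolvent (-Complex.I) (w : H) = _
  rw [h2, neg_smul, ← _root_.map_smul, h]
  abel

/-! ### Weyl matrices of two extensions. -/

section Matrix

variable {n : ℕ} (u : OrthonormalBasis (Fin n) ℂ (A.defectSpace Complex.I))

/-- The matrix of `V₂⁻¹ V₁` with respect to an orthonormal basis of `ker (A* - i)`. -/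
noncomputable def transitionMatrix
    (u : OrthonormalBasis (Fin n) ℂ (A.defectSpace Complex.I))
    (V₁ V₂ : A.defectSpace Complex.I ≃ₗᵢ[ℂ] A.defectSpace (-Complex.I)) :
    Matrix (Fin n) (Fin n) ℂ :=
  LinearMap.toMatrix u.toBasis u.toBasis
    ((V₁.toLinearEquiv.trans V₂.symm.toLinearEquiv) : _ →ₗ[ℂ] _)

theorem transitionMatrix_mulVec (w : A.defectSpace Complex.I) :
    (transitionMatrix u V₁ V₂).mulVec (u.toBasis.repr w) = u.toBasis.repr (V₂.symm (V₁ w)) :=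
  LinearMap.toMatrix_mulVec_repr u.toBasis u.toBasis _ w

theorem toMatrix_mul_transitionMatrix
    (v : Module.Basis (Fin n) ℂ (A.defectSpace (-Complex.I))) :
    LinearMap.toMatrix u.toBasis v (V₂.toLinearEquiv : _ →ₗ[ℂ] _) * transitionMatrix u V₁ V₂ =
      LinearMap.toMatrix u.toBasis v (V₁.toLinearEquiv : _ →ₗ[ℂ] _) := by
  rw [transitionMatrix, ← LinearMap.toMatrix_comp]
  congr 1
  ext w
  simp

theorem transitionMatrix_mul_symm :
    transitionMatrix u V₂ V₁ * transitionMatrix u V₁ V₂ = 1 := by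
  rw [transitionMatrix, transitionMatrix, ← LinearMap.toMatrix_comp,
    ← LinearMap.toMatrix_id u.toBasis]
  congr 1
  ext w
  simp

theorem repr_toBasis_apply (w : A.defectSpace Complex.I) (j : Fin n) :
    u.toBasis.repr w j = ⟪(u j : H), (w : H)⟫_ℂ := by
  rw [u.coe_toBasis_repr_apply, u.repr_apply_apply, Submodule.coe_inner]

theorem weylMatrix_mulVec_repr (w : A.defectSpace Complex.I) (j : Fin n) :
    (B.weylMatrix u z).mulVec (u.toBasis.repr w) j =
      z * ⟪(u j : H), (w : H)⟫_ℂ + (1 + z ^ 2) * ⟪(u j : H), B.resolvent z (w : H)⟫_ℂ := by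
  have hw : (w : H) = ∑ k, u.toBasis.repr w k • (u k : H) := by
    conv_lhs => rw [← u.toBasis.sum_repr w]
    simp
  have hR : ⟪(u j : H), B.resolvent z (w : H)⟫_ℂ =
      ∑ k, ⟪(u j : H), B.resolvent z (u k : H)⟫_ℂ * u.toBasis.repr w k := by
    conv_lhs => rw [hw]
    simp only [map_sum, _root_.map_smul, inner_sum, inner_smul_right, mul_comm]
  rw [hR, weylMatrix, Matrix.add_mulVec, Matrix.smul_mulVec, Matrix.smul_mulVec,
    Matrix.one_mulVec, ← repr_toBasis_apply]
  rfl

/-- If `w` is the component in `ker (A* - i)` of `(B - z)⁻¹ w₀`, then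
`(M(z) - i) w₀ = 2 i (z - i) w`. -/
theorem weylMatrix_sub_I_mulVec (hA : Dense (A.domain : Set H)) (g : A.domain)
    (w₀ w : A.defectSpace Complex.I)
    (hy : B.resolvent z (w₀ : H) = (g : H) + ((w : H) + (V w : H)))
    (hx : A g + Complex.I • ((w : H) - (V w : H)) - z • ((g : H) + ((w : H) + (V w : H))) = w₀) :
    (B.weylMatrix u z - Complex.I • 1).mulVec (u.toBasis.repr w₀) =
      (2 * Complex.I * (z - Complex.I)) • (u.toBasis.repr w : Fin n → ℂ) := by
  ext j
  have h := two_I_mul_inner_defectSpace hA g w (u j) hy hx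
  rw [Matrix.sub_mulVec, Pi.sub_apply, weylMatrix_mulVec_repr, Matrix.smul_mulVec,
    Matrix.one_mulVec, Pi.smul_apply, Pi.smul_apply, repr_toBasis_apply, repr_toBasis_apply,
    smul_eq_mul, smul_eq_mul]
  -- The factor `z - i` turns the coefficient `z + i` in `h` into `1 + z²`.
  linear_combination (-(z - Complex.I)) * h + (⟪(u j : H), B.resolvent z (w₀ : H)⟫_ℂ) * Complex.I_sq

/-- The relation `(M₂ - i) ((M₁ + i) - Q (M₁ - i)) = 2 i Q (M₁ - i)` between the Weyl matrices of
two extensions, with `Q` the matrix of `V₂⁻¹ V₁`. -/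
theorem weylMatrix_sub_I_mul (hA : Dense (A.domain : Set H))
    (hV₁ : A.IsVonNeumannParameter B₁ V₁) (hV₂ : A.IsVonNeumannParameter B₂ V₂)
    (hz₁ : z ∈ B₁.resolventSet) (hz₂ : z ∈ B₂.resolventSet) :
    (B₂.weylMatrix u z - Complex.I • 1) * ((B₁.weylMatrix u z + Complex.I • 1) -
      transitionMatrix u V₁ V₂ * (B₁.weylMatrix u z - Complex.I • 1)) =
    (2 * Complex.I) • (transitionMatrix u V₁ V₂ * (B₁.weylMatrix u z - Complex.I • 1)) := by
  refine Matrix.ext_of_mulVec_single fun k => ?_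
  obtain ⟨w, hw⟩ : ∃ w, (u.toBasis.repr w : Fin n → ℂ) = Pi.single k 1 :=
    ⟨u.toBasis k, by rw [Module.Basis.repr_self]; exact Finsupp.single_eq_pi_single k 1⟩
  rw [← hw]
  obtain ⟨g, v, hy, hx⟩ := hV₁.exists_resolvent_eq hz₁ (w : H)
  have h₁ := weylMatrix_sub_I_mulVec u hA g w v hy hx
  -- With this choice `V₂ v' = V₁ v`, so moving to the domain of `B₂` alters only the component in
  -- `ker (A* - i)`, on which the action is multiplication by `i`.
  set v' := V₂.symm (V₁ v) with hv'
  have hVv : V₂ v' = V₁ v := V₂.apply_symm_apply _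
  have hx₂ : A g + Complex.I • ((v' : H) - (V₂ v' : H)) -
      z • ((g : H) + ((v' : H) + (V₂ v' : H))) =
      ((w + (z - Complex.I) • (v - v') : A.defectSpace Complex.I) : H) := by
    rw [hVv, Submodule.coe_add, ← hx]
    push_cast
    module
  have h₂ := weylMatrix_sub_I_mulVec u hA g _ v' (hV₂.resolvent_eq hz₂ g v' hx₂) hx₂
  have hQ : (transitionMatrix u V₁ V₂ * (B₁.weylMatrix u z - Complex.I • 1)).mulVec
      (u.toBasis.repr w) = (2 * Complex.I * (z - Complex.I)) • (u.toBasis.repr v' : Fin n → ℂ) := by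
    rw [← Matrix.mulVec_mulVec, h₁, Matrix.mulVec_smul, transitionMatrix_mulVec]
  have hD : ((B₁.weylMatrix u z + Complex.I • 1) -
      transitionMatrix u V₁ V₂ * (B₁.weylMatrix u z - Complex.I • 1)).mulVec (u.toBasis.repr w) =
      (2 * Complex.I) • (u.toBasis.repr (w + (z - Complex.I) • (v - v')) : Fin n → ℂ) := by
    have h : B₁.weylMatrix u z + Complex.I • 1 =
        (B₁.weylMatrix u z - Complex.I • 1) + (2 * Complex.I) • 1 := by module
    rw [Matrix.sub_mulVec, hQ, h, Matrix.add_mulVec, h₁, Matrix.smul_mulVec, Matrix.one_mulVec]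
    simp only [_root_.map_add, _root_.map_smul, _root_.map_sub, Finsupp.coe_add, Finsupp.coe_smul, Finsupp.coe_sub]
    module
  rw [← Matrix.mulVec_mulVec, hD, Matrix.mulVec_smul, h₂, Matrix.smul_mulVec, hQ]

/-- The linear fractional relation between the Weyl matrices of two extensions. -/
theorem weylMatrix_mul (hA : Dense (A.domain : Set H))
    (hV₁ : A.IsVonNeumannParameter B₁ V₁) (hV₂ : A.IsVonNeumannParameter B₂ V₂)
    (hz₁ : z ∈ B₁.resolventSet) (hz₂ : z ∈ B₂.resolventSet) :
    B₂.weylMatrix u z * ((B₁.weylMatrix u z + Complex.I • 1) -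
      transitionMatrix u V₁ V₂ * (B₁.weylMatrix u z - Complex.I • 1)) =
    Complex.I • ((B₁.weylMatrix u z + Complex.I • 1) +
      transitionMatrix u V₁ V₂ * (B₁.weylMatrix u z - Complex.I • 1)) := by
  have h := weylMatrix_sub_I_mul u hA hV₁ hV₂ hz₁ hz₂
  rw [sub_mul, sub_eq_iff_eq_add, smul_mul_assoc, one_mul] at h
  rw [h]
  module

/-- The corresponding denominator with the extensions exchanged is, up to the factor `-4`, a left
inverse, which suffices for square matrices. -/
theorem isUnit_weylMatrix_denominator (hA : Dense (A.domain : Set H))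
    (hV₁ : A.IsVonNeumannParameter B₁ V₁) (hV₂ : A.IsVonNeumannParameter B₂ V₂)
    (hz₁ : z ∈ B₁.resolventSet) (hz₂ : z ∈ B₂.resolventSet) :
    IsUnit ((B₁.weylMatrix u z + Complex.I • 1) -
      transitionMatrix u V₁ V₂ * (B₁.weylMatrix u z - Complex.I • 1)) := by
  set D := (B₁.weylMatrix u z + Complex.I • 1) -
      transitionMatrix u V₁ V₂ * (B₁.weylMatrix u z - Complex.I • 1) with hD
  have h := weylMatrix_sub_I_mul u hA hV₁ hV₂ hz₁ hz₂
  rw [← hD] at h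
  have hE : ((B₂.weylMatrix u z + Complex.I • 1) -
      transitionMatrix u V₂ V₁ * (B₂.weylMatrix u z - Complex.I • 1)) * D =
      (-4 : ℂ) • 1 := by
    have h' : B₂.weylMatrix u z + Complex.I • 1 =
        (B₂.weylMatrix u z - Complex.I • 1) + (2 * Complex.I) • 1 := by module
    have hI : (-4 : ℂ) = 4 * (Complex.I * Complex.I) := by rw [Complex.I_mul_I]; ring
    rw [h', sub_mul, add_mul, mul_assoc, h, mul_smul_comm, ← mul_assoc,
      transitionMatrix_mul_symm, one_mul, hD, smul_mul_assoc, one_mul, hI]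
    module
  refine IsUnit.of_mul_eq_one_right ((-1 / 4 : ℂ) • ((B₂.weylMatrix u z + Complex.I • 1) -
      transitionMatrix u V₂ V₁ * (B₂.weylMatrix u z - Complex.I • 1))) ?_
  rw [smul_mul_assoc, hE, smul_smul]
  norm_num

end Matrix

end LinearPMap


/-! ### Identifying `Q` through bases and through Krein's formula. -/

namespace LinearPMap

variable {H : Type*} [NormedAddCommGroup H] [InnerProductSpace ℂ H] [CompleteSpace H]
  {A B₁ B₂ : H →ₗ.[ℂ] H}
  {V₁ V₂ : A.defectSpace Complex.I ≃ₗᵢ[ℂ] A.defectSpace (-Complex.I)} {z : ℂ}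
  {n : ℕ} (u : OrthonormalBasis (Fin n) ℂ (A.defectSpace Complex.I))

/-- The basis `v` cancels in `V₂⁻¹ V₁`, so it need not be orthonormal. -/
theorem transitionMatrix_eq_expI_mul (v : Module.Basis (Fin n) ℂ (A.defectSpace (-Complex.I)))
    {α β : Matrix (Fin n) (Fin n) ℂ}
    (hα : LinearMap.toMatrix u.toBasis v (V₁.toLinearEquiv : _ →ₗ[ℂ] _) = MatrixTrig.expI 2 α)
    (hβ : LinearMap.toMatrix u.toBasis v (V₂.toLinearEquiv : _ →ₗ[ℂ] _) = MatrixTrig.expI 2 β) :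
    MatrixTrig.expI (-2) β * MatrixTrig.expI 2 α = transitionMatrix u V₁ V₂ := by
  rw [← hα, ← toMatrix_mul_transitionMatrix u (V₂ := V₂) v, hβ, ← mul_assoc,
    MatrixTrig.expI_neg_mul_expI, one_mul]

/-- The difference of the resolvents at `i` of two extensions, in terms of their von Neumann
parameters. -/
theorem resolvent_I_eq_add (hA : Dense (A.domain : Set H))
    (hV₁ : A.IsVonNeumannParameter B₁ V₁) (hV₂ : A.IsVonNeumannParameter B₂ V₂)
    (hz₁ : Complex.I ∈ B₁.resolventSet) (hz₂ : Complex.I ∈ B₂.resolventSet) (x : H) :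
    ∃ w : A.defectSpace Complex.I,
      B₂.resolvent Complex.I x = B₁.resolvent Complex.I x + ((V₂.symm (V₁ w) - w :
        A.defectSpace Complex.I) : H) ∧
      ∀ w' : A.defectSpace Complex.I,
        ⟪(V₁ w' : H), x⟫_ℂ = -(2 * Complex.I) * ⟪(w' : H), (w : H)⟫_ℂ := by
  obtain ⟨g, w, hy, hx⟩ := hV₁.exists_resolvent_eq hz₁ x
  refine ⟨w, ?_, fun w' => ?_⟩
  -- At `z = i` the component in `ker (A* - i)` is annihilated, so replacing `w` by `V₂⁻¹ V₁ w`
  -- leaves the image `x` unchanged.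
  · have hVw : V₂ (V₂.symm (V₁ w)) = V₁ w := V₂.apply_symm_apply _
    rw [hV₂.resolvent_eq hz₂ g (V₂.symm (V₁ w)) (x := x), hy, hVw]
    · push_cast
      abel
    · rw [hVw, ← hx]
      module
  · have h : ⟪(V₁ w' : H), (V₁ w : H)⟫_ℂ = ⟪(w' : H), (w : H)⟫_ℂ := by
      rw [← Submodule.coe_inner, V₁.inner_map_map, Submodule.coe_inner]
    -- Here `x = (A - i) g - 2i V₁ w`, and `(A - i) g` is orthogonal to `ker (A* + i)`.
    rw [← hx]
    simp only [inner_sub_right, inner_add_right, inner_smul_right, inner_defectSpace_apply hA, h,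
      _root_.map_neg, Complex.conj_I]
    ring

/-- The matrix in Krein's formula at `i` is `(i / 2) (I - Q)`, with `Q` the matrix of
`V₂⁻¹ V₁`. -/
theorem isKreinMatrix_I_iff (hA : Dense (A.domain : Set H))
    (hV₁ : A.IsVonNeumannParameter B₁ V₁) (hV₂ : A.IsVonNeumannParameter B₂ V₂)
    (hz₁ : Complex.I ∈ B₁.resolventSet) (hz₁' : -Complex.I ∈ B₁.resolventSet)
    (hz₂ : Complex.I ∈ B₂.resolventSet) {P : Matrix (Fin n) (Fin n) ℂ} :
    B₁.IsKreinMatrix B₂ u Complex.I P ↔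
      P = (Complex.I / 2) • (1 - transitionMatrix u V₁ V₂) := by
  have hsum (x : H) (w : A.defectSpace Complex.I)
      (hw : ∀ w' : A.defectSpace Complex.I,
        ⟪(V₁ w' : H), x⟫_ℂ = -(2 * Complex.I) * ⟪(w' : H), (w : H)⟫_ℂ) :
      ∑ j, ∑ k, (P j k * ⟪B₁.transport (starRingEnd ℂ Complex.I) Complex.I (u k : H), x⟫_ℂ) •
        B₁.transport Complex.I Complex.I (u j : H) =
      ((∑ j, ((2 * Complex.I) • P).mulVec (u.toBasis.repr w) j • u j :
        A.defectSpace Complex.I) : H) := by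
    rw [Submodule.coe_sum]
    refine Finset.sum_congr rfl fun j _ => ?_
    rw [Submodule.coe_smul, Matrix.smul_mulVec, Pi.smul_apply, Matrix.mulVec, dotProduct,
      Finset.smul_sum, Finset.sum_smul]
    refine Finset.sum_congr rfl fun k _ => ?_
    rw [Complex.conj_I, transport_neg_I_I hV₁ hz₁', transport_I_I, inner_neg_left, hw,
      repr_toBasis_apply]
    congr 1
    rw [smul_eq_mul]
    ring
  have hQ (w : A.defectSpace Complex.I) : V₂.symm (V₁ w) - w =
      ∑ j, (transitionMatrix u V₁ V₂ - 1).mulVec (u.toBasis.repr w) j • u j := by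
    rw [Matrix.sub_mulVec, transitionMatrix_mulVec, Matrix.one_mulVec,
      ← u.toBasis.sum_repr (V₂.symm (V₁ w) - w)]
    simp
  have hscal : P = (Complex.I / 2) • (1 - transitionMatrix u V₁ V₂) ↔
      (2 * Complex.I) • P = transitionMatrix u V₁ V₂ - 1 := by
    have h : (2 * Complex.I) * (Complex.I / 2) = -1 := by
      linear_combination Complex.I_sq
    constructor
    · rintro rfl
      rw [smul_smul, h]
      module
    · intro hP
      rw [← neg_sub, ← hP, smul_neg, smul_smul, mul_comm, h]
      module
  rw [hscal]
  constructor
  · intro hP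
    refine Matrix.ext_of_mulVec_single fun k => ?_
    -- The test vector is scaled so that its component `w` is exactly `u k`; Krein's formula then
    -- reads off column `k` of `P`, which gives uniqueness.
    obtain ⟨w, hw, hw'⟩ := resolvent_I_eq_add hA hV₁ hV₂ hz₁ hz₂
      (-(2 * Complex.I) • (V₁ (u k) : H))
    have hwk : w = u k := by
      refine ext_inner_left ℂ fun w' => ?_
      have h := hw' w'
      rw [inner_smul_right, ← Submodule.coe_inner, V₁.inner_map_map, ← Submodule.coe_inner] at h
      exact (mul_left_cancel₀ (by simp) h).symm
    have h := hP (-(2 * Complex.I) • (V₁ (u k) : H))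
    rw [hw, hsum _ w hw', add_right_inj, hQ, Subtype.coe_inj] at h
    have h' := u.toBasis.ext_elem_iff.mp h
    have hrepr : (u.toBasis.repr w : Fin n → ℂ) = Pi.single k 1 := by
      rw [hwk, ← u.coe_toBasis, Module.Basis.repr_self]
      exact Finsupp.single_eq_pi_single k 1
    rw [← hrepr]
    ext j
    have := h' j
    simp only [← u.coe_toBasis, Module.Basis.repr_sum_self] at this
    exact this.symm
  · intro hP x
    obtain ⟨w, hw, hw'⟩ := resolvent_I_eq_add hA hV₁ hV₂ hz₁ hz₂ x
    rw [hw, hsum x w hw', hP, hQ]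

/-- The transported basis is `-V₁ u_k`, so `e^{2iγ}` is minus the matrix of `V₁⁻¹ V₂`, that is
`-Q⁻¹`. -/
theorem transitionMatrix_eq_neg_expI (hV₁ : A.IsVonNeumannParameter B₁ V₁)
    (hz₁' : -Complex.I ∈ B₁.resolventSet) {γ : Matrix (Fin n) (Fin n) ℂ}
    (hγ : ∀ j, (V₂ (u j) : H) =
      ∑ k, MatrixTrig.expI 2 γ k j • B₁.transport (-Complex.I) Complex.I (u k : H)) :
    transitionMatrix u V₁ V₂ = -MatrixTrig.expI (-2) γ := by
  have h : transitionMatrix u V₂ V₁ = -MatrixTrig.expI 2 γ := by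
    ext i j
    have hj : V₂ (u j) = V₁ (∑ k, (-MatrixTrig.expI 2 γ) k j • u.toBasis k) := by
      apply Subtype.ext
      rw [hγ j, _root_.map_sum, Submodule.coe_sum]
      refine Finset.sum_congr rfl fun k _ => ?_
      rw [transport_neg_I_I hV₁ hz₁', _root_.map_smul, Submodule.coe_smul, Matrix.neg_apply,
        smul_neg, neg_smul, u.coe_toBasis]
    rw [transitionMatrix, LinearMap.toMatrix_apply]
    change u.toBasis.repr (V₁.symm (V₂ (u.toBasis j))) i = _
    rw [u.coe_toBasis, hj, V₁.symm_apply_apply, Module.Basis.repr_sum_self]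
  have h' := transitionMatrix_mul_symm u (V₁ := V₂) (V₂ := V₁)
  rw [h, mul_neg, ← neg_mul] at h'
  calc transitionMatrix u V₁ V₂
      = -(-transitionMatrix u V₁ V₂ * MatrixTrig.expI 2 γ) * MatrixTrig.expI (-2) γ := by
        rw [neg_mul (transitionMatrix u V₁ V₂), neg_neg, mul_assoc,
          MatrixTrig.expI_mul_expI_neg, mul_one]
    _ = -MatrixTrig.expI (-2) γ := by rw [h', neg_mul, one_mul]

end LinearPMap

/-! ### Algebra of the linear fractional forms. -/

namespace Matrix

/-- A linear fractional relation `Y * D = N` with invertible `D`, up to a common left factor. -/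
theorem isUnit_and_eq_mul_inv {n : ℕ} {Y D N : Matrix (Fin n) (Fin n) ℂ} {c : ℂ} (hc : c ≠ 0)
    (hD : IsUnit (c • D)) (h : Y * (c • D) = c • N) : IsUnit D ∧ Y = N * D⁻¹ := by
  have hD' : IsUnit D := by
    rw [Matrix.isUnit_iff_isUnit_det, Matrix.det_smul] at hD
    exact (Matrix.isUnit_iff_isUnit_det D).mpr (isUnit_of_mul_isUnit_right hD)
  refine ⟨hD', ?_⟩
  rw [mul_smul_comm] at h
  rw [← smul_right_injective _ hc h, Matrix.mul_nonsing_inv_cancel_right _ _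
    ((Matrix.isUnit_iff_isUnit_det D).mp hD')]

/-- The linear fractional form of a relation between `X` and `Y` given by Cayley transforms. -/
theorem isUnit_and_eq_linearFractional {n : ℕ} {X Y Q C S : Matrix (Fin n) (Fin n) ℂ}
    (hu : IsUnit ((X + Complex.I • 1) - Q * (X - Complex.I • 1)))
    (hm : Y * ((X + Complex.I • 1) - Q * (X - Complex.I • 1)) =
      Complex.I • ((X + Complex.I • 1) + Q * (X - Complex.I • 1)))
    (hC : C = (1 / 2 : ℂ) • (1 + Q)) (hS : S = -(Complex.I / 2) • (1 - Q)) :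
    IsUnit (C + S * X) ∧ Y = (-S + C * X) * (C + S * X)⁻¹ := by
  have hI : Complex.I * Complex.I = -1 := Complex.I_mul_I
  have hD : (2 * Complex.I : ℂ) • (C + S * X) =
      (X + Complex.I • 1) - Q * (X - Complex.I • 1) := by
    simp only [hC, hS, smul_mul_assoc, mul_sub, sub_mul, one_mul, mul_smul_comm, mul_one]
    match_scalars <;> grind
  refine isUnit_and_eq_mul_inv (c := 2 * Complex.I) (by simp) (hD ▸ hu) ?_
  rw [hD, hm]
  simp only [hC, hS, smul_mul_assoc, mul_sub, add_mul, one_mul, mul_smul_comm, mul_one]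
  match_scalars <;> grind

end Matrix

namespace MatrixTrig

/-- The relation between `X` and `Y` in the case `Q = -e^{-2iγ}`. -/
theorem isUnit_sin_sub_cos_mul {n : ℕ} {X Y γ : Matrix (Fin n) (Fin n) ℂ}
    (hu : IsUnit ((X + Complex.I • 1) - -expI (-2) γ * (X - Complex.I • 1)))
    (hm : Y * ((X + Complex.I • 1) - -expI (-2) γ * (X - Complex.I • 1)) =
      Complex.I • ((X + Complex.I • 1) + -expI (-2) γ * (X - Complex.I • 1))) :
    IsUnit (sin γ - cos γ * X) ∧
      Y = expI (-1) γ * (cos γ + sin γ * X) * (sin γ - cos γ * X)⁻¹ * expI 1 γ := by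
  have hI : Complex.I * Complex.I = -1 := Complex.I_mul_I
  have hinv : (1 / (2 * Complex.I) : ℂ) = -(Complex.I / 2) := by
    field_simp
    linear_combination Complex.I_sq
  have h₀ : expI (-1) γ * expI 1 γ = 1 := expI_neg_mul_expI 1 γ
  have h₀' : expI 1 γ * expI (-1) γ = 1 := expI_mul_expI_neg 1 γ
  have h₂ : expI (-1) γ * expI (-1) γ = expI (-2) γ := expI_mul_of_add (by norm_num) γ
  -- Numerator and denominator share the left factor `-2 e^{-iγ}`. Its matrix part does not cancel
  -- but conjugates the quotient, whence the outer factors `e^{-iγ}` and `e^{iγ}`.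
  have hD : (-2 : ℂ) • (expI (-1) γ * (sin γ - cos γ * X)) =
      (X + Complex.I • 1) - -expI (-2) γ * (X - Complex.I • 1) := by
    simp only [cos, sin, hinv, ← h₂, smul_mul_assoc, mul_sub, mul_add, add_mul, mul_smul_comm,
      mul_one, ← mul_assoc, h₀, one_mul, neg_mul]
    match_scalars <;> grind
  have hN : (-2 : ℂ) • (expI (-1) γ * (cos γ + sin γ * X)) =
      Complex.I • ((X + Complex.I • 1) + -expI (-2) γ * (X - Complex.I • 1)) := by
    simp only [cos, sin, hinv, ← h₂, smul_mul_assoc, mul_sub, mul_add, sub_mul,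
      mul_smul_comm, mul_one, ← mul_assoc, h₀, one_mul, neg_mul]
    match_scalars <;> grind
  obtain ⟨h, hY⟩ := Matrix.isUnit_and_eq_mul_inv (c := -2) (by norm_num) (hD ▸ hu)
    (hD ▸ hN ▸ hm)
  have hF : IsUnit (sin γ - cos γ * X) := by
    have h' := (IsUnit.of_mul_eq_one_right _ h₀).mul h
    rwa [← mul_assoc, h₀', one_mul] at h'
  refine ⟨hF, ?_⟩
  rw [hY, Matrix.mul_inv_rev, Matrix.inv_eq_left_inv h₀', mul_assoc, mul_assoc, mul_assoc]

end MatrixTrig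


/-! ### The theorem, from the three descriptions of `Q`. -/

theorem theoremB6 {H : Type*} [NormedAddCommGroup H] [InnerProductSpace ℂ H] [CompleteSpace H]
    (n : ℕ) (A Aα Aβ : H →ₗ.[ℂ] H)
    (hA_dense : Dense (A.domain : Set H)) (hA_closed : A.IsClosed)
    (hA_symm : A.IsFormalAdjoint A)
    (hα_ext : A ≤ Aα) (hα_sa : IsSelfAdjoint Aα)
    (hβ_ext : A ≤ Aβ) (hβ_sa : IsSelfAdjoint Aβ)
    (Vα Vβ : A.defectSpace Complex.I ≃ₗᵢ[ℂ] A.defectSpace (-Complex.I))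
    (hVα : A.IsVonNeumannParameter Aα Vα) (hVβ : A.IsVonNeumannParameter Aβ Vβ)
    (u : OrthonormalBasis (Fin n) ℂ (A.defectSpace Complex.I)) :
    -- the linear fractional transformation, for an arbitrary basis of `ker (A* + i)`
    (∀ (v : Module.Basis (Fin n) ℂ (A.defectSpace (-Complex.I)))
        (α β : Matrix (Fin n) (Fin n) ℂ),
        LinearMap.toMatrix u.toBasis v (Vα.toLinearEquiv : _ →ₗ[ℂ] _) = MatrixTrig.expI 2 α →
        LinearMap.toMatrix u.toBasis v (Vβ.toLinearEquiv : _ →ₗ[ℂ] _) = MatrixTrig.expI 2 β →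
        ∀ z ∈ Aα.resolventSet ∩ Aβ.resolventSet,
          IsUnit (MatrixTrig.cosBlock α β + MatrixTrig.sinBlock α β * Aα.weylMatrix u z) ∧
          Aβ.weylMatrix u z = (-MatrixTrig.sinBlock α β + MatrixTrig.cosBlock α β * Aα.weylMatrix u z) *
            (MatrixTrig.cosBlock α β + MatrixTrig.sinBlock α β * Aα.weylMatrix u z)⁻¹) ∧
    -- the coefficients do not depend on the basis of `ker (A* + i)`
    (∀ (v v' : Module.Basis (Fin n) ℂ (A.defectSpace (-Complex.I)))
        (α β α' β' : Matrix (Fin n) (Fin n) ℂ),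
        LinearMap.toMatrix u.toBasis v (Vα.toLinearEquiv : _ →ₗ[ℂ] _) = MatrixTrig.expI 2 α →
        LinearMap.toMatrix u.toBasis v (Vβ.toLinearEquiv : _ →ₗ[ℂ] _) = MatrixTrig.expI 2 β →
        LinearMap.toMatrix u.toBasis v' (Vα.toLinearEquiv : _ →ₗ[ℂ] _) = MatrixTrig.expI 2 α' →
        LinearMap.toMatrix u.toBasis v' (Vβ.toLinearEquiv : _ →ₗ[ℂ] _) = MatrixTrig.expI 2 β' →
        MatrixTrig.cosBlock α' β' = MatrixTrig.cosBlock α β ∧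
        MatrixTrig.sinBlock α' β' = MatrixTrig.sinBlock α β) ∧
    -- the transformation in terms of the matrix `P` of Krein's formula at `i`, and, in the basis
    -- `(Aα - i)(Aα + i)⁻¹ u_k` of `ker (A* + i)`, in terms of the parameter of `Aβ` alone
    (∃! P : Matrix (Fin n) (Fin n) ℂ, Aα.IsKreinMatrix Aβ u Complex.I P) ∧
    (∀ P : Matrix (Fin n) (Fin n) ℂ, Aα.IsKreinMatrix Aβ u Complex.I P →
      ∀ z ∈ Aα.resolventSet ∩ Aβ.resolventSet,
        IsUnit ((1 + Complex.I • P) - P * Aα.weylMatrix u z) ∧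
        Aβ.weylMatrix u z = (P + (1 + Complex.I • P) * Aα.weylMatrix u z) * ((1 + Complex.I • P) - P * Aα.weylMatrix u z)⁻¹) ∧
    (∀ γ : Matrix (Fin n) (Fin n) ℂ,
      (∀ j, (Vβ (u j) : H) =
        ∑ k, MatrixTrig.expI 2 γ k j • Aα.transport (-Complex.I) Complex.I (u k : H)) →
      ∀ z ∈ Aα.resolventSet ∩ Aβ.resolventSet,
        IsUnit (MatrixTrig.sin γ - MatrixTrig.cos γ * Aα.weylMatrix u z) ∧
        Aβ.weylMatrix u z = MatrixTrig.expI (-1) γ * (MatrixTrig.cos γ + MatrixTrig.sin γ * Aα.weylMatrix u z) *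
          (MatrixTrig.sin γ - MatrixTrig.cos γ * Aα.weylMatrix u z)⁻¹ * MatrixTrig.expI 1 γ) := by
  have hiα := LinearPMap.I_mem_resolventSet hα_sa
  have hiα' := LinearPMap.neg_I_mem_resolventSet hα_sa
  have hiβ := LinearPMap.I_mem_resolventSet hβ_sa
  refine ⟨?_, ?_, ?_, ?_, ?_⟩
  · intro v α β hα hβ z hz
    refine Matrix.isUnit_and_eq_linearFractional
      (LinearPMap.isUnit_weylMatrix_denominator u hA_dense hVα hVβ hz.1 hz.2)
      (LinearPMap.weylMatrix_mul u hA_dense hVα hVβ hz.1 hz.2) ?_ ?_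
    · rw [MatrixTrig.cosBlock_eq, LinearPMap.transitionMatrix_eq_expI_mul u v hα hβ]
    · rw [MatrixTrig.sinBlock_eq, LinearPMap.transitionMatrix_eq_expI_mul u v hα hβ]
      congr 1
      field_simp
      linear_combination Complex.I_sq
  · intro v v' α β α' β' hα hβ hα' hβ'
    simp only [MatrixTrig.cosBlock_eq, MatrixTrig.sinBlock_eq,
      LinearPMap.transitionMatrix_eq_expI_mul u v hα hβ,
      LinearPMap.transitionMatrix_eq_expI_mul u v' hα' hβ', and_self]
  · exact ⟨_, (LinearPMap.isKreinMatrix_I_iff u hA_dense hVα hVβ hiα hiα' hiβ).mpr rfl,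
      fun P hP => (LinearPMap.isKreinMatrix_I_iff u hA_dense hVα hVβ hiα hiα' hiβ).mp hP⟩
  · intro P hP z hz
    have hPQ := (LinearPMap.isKreinMatrix_I_iff u hA_dense hVα hVβ hiα hiα' hiβ).mp hP
    -- From `P = (i/2)(1 - Q)` one gets `1 + iP = (1 + Q)/2`, so these are the blocks `C` and `S` of
    -- the first formula.
    have h := Matrix.isUnit_and_eq_linearFractional (C := 1 + Complex.I • P) (S := -P)
      (LinearPMap.isUnit_weylMatrix_denominator u hA_dense hVα hVβ hz.1 hz.2)
      (LinearPMap.weylMatrix_mul u hA_dense hVα hVβ hz.1 hz.2)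
      (by rw [hPQ]; have hI := Complex.I_mul_I; match_scalars <;> grind)
      (by rw [hPQ, neg_smul])
    rwa [neg_neg, neg_mul, ← sub_eq_add_neg] at h
  · intro γ hγ z hz
    have hQ := LinearPMap.transitionMatrix_eq_neg_expI u hVα hiα' hγ
    have hu := LinearPMap.isUnit_weylMatrix_denominator u hA_dense hVα hVβ hz.1 hz.2
    have hm := LinearPMap.weylMatrix_mul u hA_dense hVα hVβ hz.1 hz.2
    rw [hQ] at hu hm
    exact MatrixTrig.isUnit_sin_sub_cos_mul hu hm
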